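/- Let $S_\infty$ be the group of permutations of $\{1,2,3,\dots\}$ fixing all but finitely many elements, let $s_i\in S_\infty$ exchange $i$ and $i+1$, and let $\ell(w)$ be the least length of an expression of $w$ as a product of the $s_i$. Write $u\le_L w$ (left weak order) if $w=zu$ for some $z\in S_\infty$ with $\ell(z)+\ell(u)=\ell(w)$. Let $N_i f=\dfrac{f-s_i\cdot f}{x_i-x_{i+1}}$ for $f\in\mathbb Z[x_1,x_2,\dots]$, where $s_i$ swaps $x_i$ and $x_{i+1}$. The Schubert polynomials $\mathfrak S_w$, $w\in S_\infty$, are defined recursively by $\mathfrak S_{w_0}=x_1^{n-1}x_2^{n-2}\cdots x_n^0$ for the long element $w_0 = n\,(n-1)\cdots 1$ of $S_n\subset S_\infty$ (all $n$), and $\mathfrak S_{ws_i}=N_i\mathfrak S_w$ whenever $w(i)>w(i+1)$. The recursion is consistent, so it determines each $\mathfrak S_w$ uniquely, and $\{\mathfrak S_w\}_{w\in S_\infty}$ is a $\mathbb Z$-basis of $\mathbb Z[x_1,x_2,\dots]$. Let $c_{u,v}^w$ be the structure coefficients of this basis, $\mathfrak S_u\mathfrak S_v=\sum_w c_{u,v}^w\,\mathfrak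 S_w$, and let $\mathfrak S_w(\mathbf 1)$ be the value of $\mathfrak S_w$ with all variables set to $1$. **Proposition.** Let $u,v\in S_\infty$, let $1\le k\le \ell(u)+\ell(v)$, and let $w\in S_\infty$ satisfy $\ell(w)=\ell(u)+\ell(v)-k$. Then $$\sum_{\substack{\hat w\ge_L w\\ \ell(\hat w)=\ell(w)+k}} c_{u,v}^{\hat w}\,\mathfrak S_{\hat w w^{-1}}(\mathbf 1)=\sum_{i=0}^{k}\ \sum_{\substack{\hat u\le_L u\\ \ell(\hat u)=\ell(u)-i}}\ \sum_{\substack{\hat v\le_L v\\ \ell(\hat v)=\ell(v)-(k-i)}} c_{\hat u,\hat v}^{w}\,\mathfrak S_{u\hat u^{-1}}(\mathbf 1)\,\mathfrak S_{v\hat v^{-1}}(\mathbf 1).$$ -/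

import Mathlib

open MvPolynomial

/-- The infinite symmetric group: permutations fixing all but finitely many elements.
The underlying set is `ℕ = {0, 1, 2, …}`, where `i` stands for the positive integer `i + 1`. -/
def SInf : Subgroup (Equiv.Perm ℕ) where
  carrier := {w | ∃ n, ∀ i, n ≤ i → w i = i}
  one_mem' := ⟨0, fun _ _ => rfl⟩
  mul_mem' := by
    rintro a b ⟨m, hm⟩ ⟨n, hn⟩
    refine ⟨max m n, fun i hi => ?_⟩
    rw [Equiv.Perm.mul_apply, hn i (le_trans (le_max_right _ _) hi),
      hm i (le_trans (le_max_left _ _) hi)]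
  inv_mem' := by
    rintro a ⟨n, hn⟩
    refine ⟨n, fun i hi => ?_⟩
    rw [Equiv.Perm.inv_eq_iff_eq, hn i hi]

namespace SInf

/-- The simple transposition exchanging `i` and `i + 1`. -/
def simple (i : ℕ) : SInf :=
  ⟨Equiv.swap i (i + 1), i + 2, fun j hj =>
    Equiv.swap_apply_of_ne_of_ne (by omega) (by omega)⟩

/-- Coxeter length: the least length of an expression as a product of simple transpositions. -/
noncomputable def length (w : SInf) : ℕ :=
  sInf {m | ∃ l : List ℕ, l.length = m ∧ (l.map simple).prod = w}

/-- Left weak order: `u ≤_L w` iff `w = v u` for some `v` with `ℓ(u) + ℓ(v) = ℓ(w)`. -/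
def LeftWeakLE (u w : SInf) : Prop :=
  ∃ v : SInf, w = v * u ∧ length u + length v = length w

/-- The long element of `S_n`, reversing `0, …, n - 1` and fixing all `i ≥ n`. -/
def longElement (n : ℕ) : SInf :=
  ⟨{ toFun := fun i => if i < n then n - 1 - i else i
     invFun := fun i => if i < n then n - 1 - i else i
     left_inv := by intro i; dsimp only; split_ifs <;> omega
     right_inv := by intro i; dsimp only; split_ifs <;> omega },
    n, fun i hi => if_neg (by omega)⟩

end SInf

theorem X_sub_X_dvd_sub_rename_swap (i : ℕ) (f : MvPolynomial ℕ ℤ) :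
    (X i - X (i + 1) : MvPolynomial ℕ ℤ) ∣ f - rename (Equiv.swap i (i + 1)) f := by
  induction f using MvPolynomial.induction_on with
  | C a => simp
  | add p q hp hq =>
    rw [map_add, add_sub_add_comm]
    exact dvd_add hp hq
  | mul_X p j hp =>
    have hX : (X i - X (i + 1) : MvPolynomial ℕ ℤ) ∣ X j - X (Equiv.swap i (i + 1) j) := by
      by_cases h1 : j = i
      · subst h1; rw [Equiv.swap_apply_left]
      · by_cases h2 : j = i + 1
        · subst h2; rw [Equiv.swap_apply_right, ← neg_sub (X i), dvd_neg]
        · rw [Equiv.swap_apply_of_ne_of_ne h1 h2, sub_self]; exact dvd_zero _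
    rw [map_mul, rename_X]
    have : p * X j - rename (Equiv.swap i (i + 1)) p * X (Equiv.swap i (i + 1) j)
        = (p - rename (Equiv.swap i (i + 1)) p) * X j
          + rename (Equiv.swap i (i + 1)) p * (X j - X (Equiv.swap i (i + 1) j)) := by ring
    rw [this]
    exact dvd_add (Dvd.dvd.mul_right hp _) (Dvd.dvd.mul_left hX _)

/-- The Newton divided difference operator: `dividedDiff i f` is the polynomial quotient
`(f - s_i f) / (x_i - x_{i+1})`. -/
noncomputable def dividedDiff (i : ℕ) (f : MvPolynomial ℕ ℤ) : MvPolynomial ℕ ℤ :=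
  Classical.choose (X_sub_X_dvd_sub_rename_swap i f)

theorem dividedDiff_spec (i : ℕ) (f : MvPolynomial ℕ ℤ) :
    f - rename (Equiv.swap i (i + 1)) f = (X i - X (i + 1)) * dividedDiff i f :=
  Classical.choose_spec (X_sub_X_dvd_sub_rename_swap i f)

/-- The recursive definition of Schubert polynomials, as a relation: `IsSchubert w f` says that
the recursion assigns `f` to `w`. -/
inductive IsSchubert : SInf → MvPolynomial ℕ ℤ → Prop
  | long (n : ℕ) :
      IsSchubert (SInf.longElement n) (∏ i ∈ Finset.range n, X i ^ (n - 1 - i))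
  | step (w : SInf) (f : MvPolynomial ℕ ℤ) (i : ℕ) (hw : w.1 (i + 1) < w.1 i)
      (hf : IsSchubert w f) : IsSchubert (w * SInf.simple i) (dividedDiff i f)

theorem exists_isSchubert (w : SInf) : ∃ f, IsSchubert w f := by
  obtain ⟨n, hn⟩ := w.2
  have key : ∀ (m : ℕ) (w : SInf), (∀ i, n ≤ i → w.1 i = i) →
      ∑ i ∈ Finset.range n, i * w.1 i = m → ∃ f, IsSchubert w f := by
    intro m
    induction m using Nat.strong_induction_on with
    | _ m ih =>
    intro w hn hm
    have hlt : ∀ i, i < n → w.1 i < n := by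
      intro i hi
      by_contra hc
      have := w.1.injective (hn (w.1 i) (by omega))
      omega
    by_cases h : ∃ i, i + 1 < n ∧ w.1 i < w.1 (i + 1)
    · obtain ⟨i, hi, hasc⟩ := h
      have e0 : (w * SInf.simple i).1 i = w.1 (i + 1) := by simp [SInf.simple]
      have e1 : (w * SInf.simple i).1 (i + 1) = w.1 i := by simp [SInf.simple]
      have e2 : ∀ j, j ≠ i → j ≠ i + 1 → (w * SInf.simple i).1 j = w.1 j := by
        intro j h1 h2
        simp [SInf.simple, Equiv.swap_apply_of_ne_of_ne h1 h2]
      have hsplit : ∀ g : ℕ → ℕ, ∑ j ∈ Finset.range n, g j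
          = g i + (g (i + 1) + ∑ j ∈ ((Finset.range n).erase i).erase (i + 1), g j) := by
        intro g
        rw [Finset.add_sum_erase _ _ (by simp [hi]), Finset.add_sum_erase _ _ (by simp; omega)]
      have hdec : ∑ j ∈ Finset.range n, j * (w * SInf.simple i).1 j < m := by
        rw [← hm, hsplit, hsplit (fun j => j * w.1 j), e0, e1]
        have : ∑ j ∈ ((Finset.range n).erase i).erase (i + 1), j * (w * SInf.simple i).1 j
            = ∑ j ∈ ((Finset.range n).erase i).erase (i + 1), j * w.1 j := by
          refine Finset.sum_congr rfl fun j hj => ?_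
          simp only [Finset.mem_erase] at hj
          rw [e2 j hj.2.1 hj.1]
        rw [this]
        nlinarith
      obtain ⟨f, hf⟩ := ih _ hdec (w * SInf.simple i) (by
        intro j hj
        rw [e2 j (by omega) (by omega), hn j hj]) rfl
      refine ⟨dividedDiff i f, ?_⟩
      have := IsSchubert.step _ f i (by rw [e0, e1]; exact hasc) hf
      have hs : SInf.simple i * SInf.simple i = 1 := by
        apply Subtype.ext
        simp [SInf.simple]
      rwa [mul_assoc, hs, mul_one] at this
    · push Not at h
      have hdesc : ∀ i, i + 1 < n → w.1 (i + 1) < w.1 i := by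
        intro i hi
        refine lt_of_le_of_ne (h i hi) fun he => ?_
        have := w.1.injective he
        omega
      have hup : ∀ i, i < n → w.1 i ≤ n - 1 - i := by
        intro i
        induction i with
        | zero => intro hi; have := hlt 0 hi; omega
        | succ i ihi =>
          intro hi
          have := ihi (by omega)
          have := hdesc i hi
          omega
      have hlow : ∀ j, j < n → j ≤ w.1 (n - 1 - j) := by
        intro j
        induction j with
        | zero => intro _; omega
        | succ j ihj =>
          intro hj
          have h1 := ihj (by omega)
          have h2 := hdesc (n - 1 - (j + 1)) (by omega)
          rw [show n - 1 - (j + 1) + 1 = n - 1 - j by omega] at h2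
          omega
      have hw : w = SInf.longElement n := by
        apply Subtype.ext
        ext i
        change w.1 i = if i < n then n - 1 - i else i
        split_ifs with hi
        · have h1 := hup i hi
          have h2 := hlow (n - 1 - i) (by omega)
          rw [show n - 1 - (n - 1 - i) = i by omega] at h2
          omega
        · exact hn i (by omega)
      exact ⟨_, hw ▸ IsSchubert.long n⟩
  exact key _ w hn rfl

/-- The Schubert polynomial of `w ∈ S_∞`; the variable `X i` stands for `x_{i+1}`. -/
noncomputable def schubert (w : SInf) : MvPolynomial ℕ ℤ :=
  Classical.choose (exists_isSchubert w)

theorem schubert_spec (w : SInf) : IsSchubert w (schubert w) :=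
  Classical.choose_spec (exists_isSchubert w)

/-- The specialization of the Schubert polynomial of `w` at `x_1 = x_2 = ⋯ = 1`. -/
noncomputable def schubertAtOne (w : SInf) : ℤ :=
  eval (fun _ => 1) (schubert w)

/-- The Schubert structure coefficients: `structureCoeff u v w` is the coefficient of `schubert w`
in the expansion of `schubert u * schubert v` as a finite linear combination of Schubert
polynomials. -/
noncomputable def structureCoeff (u v : SInf) : SInf →₀ ℤ :=
  Classical.epsilon fun c : SInf →₀ ℤ =>
    Finsupp.linearCombination ℤ schubert c = schubert u * schubert v

/-! ### Divided differences -/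

/-! Let T be the substitution x_i ↦ x_i + 1. It fixes every x_i - x_{i+1} and commutes with
permuting variables, so it commutes with all divided differences. The coefficient of 𝔖_v in a
polynomial is found by applying divided differences along a reduced word of v and evaluating at 0.
For T 𝔖_w this yields 𝔖_{wv⁻¹}(1) if v ≤_L w, and 0 otherwise (`schubertCoords_shiftVars_schubert`).
As T is a ring homomorphism, the relation compares the coefficient of 𝔖_w in T(𝔖_u 𝔖_v), expanded
after multiplying, with that in T(𝔖_u) T(𝔖_v), expanded before. Homogeneity supplies the length
conditions.

Two foundations carry this. The recursion is consistent (`IsSchubertFrom.existsUnique`,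
`IsSchubertFrom.succ`): divided differences satisfy the commutation and braid relations, and the
staircase monomial of S_{n+1} descends to that of S_n. The Schubert polynomials form a basis:
independence comes from the coefficient extraction above, spanning from induction on degree using
`exists_dividedDiff_sub_eq_zero`. -/

theorem X_sub_X_succ_ne_zero (i : ℕ) : (X i - X (i + 1) : MvPolynomial ℕ ℤ) ≠ 0 := by
  rw [sub_ne_zero]
  intro h
  have := X_injective (σ := ℕ) (R := ℤ) h
  omega

/-- The quotient is obtained by choice, so it is computed by multiplying back and cancelling in a
domain. -/
theorem dividedDiff_eq_of_mul_eq {i : ℕ} {f g : MvPolynomial ℕ ℤ}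
    (h : (X i - X (i + 1)) * g = f - rename (Equiv.swap i (i + 1)) f) : dividedDiff i f = g :=
  mul_left_cancel₀ (X_sub_X_succ_ne_zero i) ((dividedDiff_spec i f).symm.trans h.symm)

/-- The divided difference operator as a linear map. -/
noncomputable def dividedDiffLin (i : ℕ) : MvPolynomial ℕ ℤ →ₗ[ℤ] MvPolynomial ℕ ℤ where
  toFun := dividedDiff i
  map_add' f g := dividedDiff_eq_of_mul_eq (by
    rw [mul_add, ← dividedDiff_spec, ← dividedDiff_spec, map_add]; ring)
  map_smul' c f := dividedDiff_eq_of_mul_eq (by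
    rw [RingHom.id_apply, mul_smul_comm, ← dividedDiff_spec, map_smul, smul_sub])

@[simp] theorem dividedDiffLin_apply (i : ℕ) (f : MvPolynomial ℕ ℤ) :
    dividedDiffLin i f = dividedDiff i f := rfl

@[simp] theorem dividedDiff_zero (i : ℕ) : dividedDiff i 0 = 0 := map_zero (dividedDiffLin i)

theorem dividedDiff_eq_zero_iff (i : ℕ) (f : MvPolynomial ℕ ℤ) :
    dividedDiff i f = 0 ↔ rename (Equiv.swap i (i + 1)) f = f := by
  constructor
  · intro h
    have := dividedDiff_spec i f
    rw [h, mul_zero, sub_eq_zero] at this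
    exact this.symm
  · intro h
    exact dividedDiff_eq_of_mul_eq (by rw [h]; ring)

theorem rename_rename_perm (σ τ : Equiv.Perm ℕ) (f : MvPolynomial ℕ ℤ) :
    rename σ (rename τ f) = rename (σ * τ : Equiv.Perm ℕ) f := by
  rw [rename_rename]; rfl

theorem rename_swap_rename_swap (i j : ℕ) (f : MvPolynomial ℕ ℤ) :
    rename (Equiv.swap i j) (rename (Equiv.swap i j) f) = f := by
  rw [rename_rename_perm, Equiv.swap_mul_self]
  exact rename_id_apply f

theorem rename_swap_dividedDiff (i : ℕ) (f : MvPolynomial ℕ ℤ) :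
    rename (Equiv.swap i (i + 1)) (dividedDiff i f) = dividedDiff i f := by
  apply mul_left_cancel₀ (X_sub_X_succ_ne_zero i)
  have h := congrArg (rename (Equiv.swap i (i + 1))) (dividedDiff_spec i f)
  rw [map_sub, rename_swap_rename_swap, map_mul, map_sub, rename_X, rename_X,
    Equiv.swap_apply_left, Equiv.swap_apply_right] at h
  rw [← dividedDiff_spec]
  linear_combination h

theorem dividedDiff_dividedDiff_self (i : ℕ) (f : MvPolynomial ℕ ℤ) :
    dividedDiff i (dividedDiff i f) = 0 :=
  (dividedDiff_eq_zero_iff i _).2 (rename_swap_dividedDiff i f)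

theorem dividedDiff_X_mul {i : ℕ} {f : MvPolynomial ℕ ℤ}
    (h : rename (Equiv.swap i (i + 1)) f = f) : dividedDiff i (X i * f) = f :=
  dividedDiff_eq_of_mul_eq (by
    rw [map_mul, rename_X, Equiv.swap_apply_left, h]; ring)

theorem swap_mul_swap_of_far {i j : ℕ} (h : i + 1 < j) :
    (Equiv.swap i (i + 1) * Equiv.swap j (j + 1) : Equiv.Perm ℕ)
      = Equiv.swap j (j + 1) * Equiv.swap i (i + 1) := by
  ext k
  simp only [Equiv.Perm.mul_apply, Equiv.swap_apply_def]
  split_ifs <;> omega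

theorem swap_braid (i : ℕ) :
    (Equiv.swap i (i + 1) * Equiv.swap (i + 1) (i + 2) * Equiv.swap i (i + 1) : Equiv.Perm ℕ)
      = Equiv.swap (i + 1) (i + 2) * Equiv.swap i (i + 1) * Equiv.swap (i + 1) (i + 2) := by
  ext k
  simp only [Equiv.Perm.mul_apply, Equiv.swap_apply_def]
  split_ifs <;> omega

theorem dividedDiff_comm {i j : ℕ} (h : i + 1 < j) (f : MvPolynomial ℕ ℤ) :
    dividedDiff i (dividedDiff j f) = dividedDiff j (dividedDiff i f) := by
  apply mul_left_cancel₀ (X_sub_X_succ_ne_zero j)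
  apply mul_left_cancel₀ (X_sub_X_succ_ne_zero i)
  have hi := dividedDiff_spec i f
  have hj := dividedDiff_spec j f
  have hij := dividedDiff_spec i (dividedDiff j f)
  have hji := dividedDiff_spec j (dividedDiff i f)
  have hi' := congrArg (rename (Equiv.swap j (j + 1))) hi
  have hj' := congrArg (rename (Equiv.swap i (i + 1))) hj
  have e1 : Equiv.swap j (j + 1) i = i := Equiv.swap_apply_of_ne_of_ne (by omega) (by omega)
  have e2 : Equiv.swap j (j + 1) (i + 1) = i + 1 :=
    Equiv.swap_apply_of_ne_of_ne (by omega) (by omega)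
  have e3 : Equiv.swap i (i + 1) j = j := Equiv.swap_apply_of_ne_of_ne (by omega) (by omega)
  have e4 : Equiv.swap i (i + 1) (j + 1) = j + 1 :=
    Equiv.swap_apply_of_ne_of_ne (by omega) (by omega)
  rw [map_sub, map_mul, map_sub, rename_X, rename_X, e1, e2, rename_rename_perm] at hi'
  rw [map_sub, map_mul, map_sub, rename_X, rename_X, e3, e4, rename_rename_perm,
    swap_mul_swap_of_far h] at hj'
  linear_combination -(X j - X (j + 1) : MvPolynomial ℕ ℤ) * hij
    + (X i - X (i + 1) : MvPolynomial ℕ ℤ) * hji + hi - hi' - hj + hj'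

/-- Iterating three divided differences along a braid, in a ring with two involutions acting
on the differences `a`, `b` as simple reflections act on simple roots. -/
theorem braid_word_expansion {R : Type*} [CommRing R] (s t : R →+* R)
    {a b f g h k : R} (sa : s a = -a) (sb : s b = a + b) (ta : t a = a + b)
    (ss : ∀ x, s (s x) = x)
    (hg : f - s f = a * g) (hh : g - t g = b * h) (hk : h - s h = a * k) :
    a * (a * b * (a + b) * k)
      = a * (f - s f - t f + s (t f) + t (s f) - s (t (s f))) := by
  have h1 := congrArg t hg
  have h2 := congrArg s hg
  have h3 := congrArg s hh
  have h4 := congrArg s h1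
  simp only [map_sub, map_mul, map_add, sa, sb, ta, ss] at h1 h2 h3 h4
  -- Combining `hg` and `h2` gives `a * s g = a * g`. As `R` need not be a domain, `s g = g` is
  -- unavailable, hence the spare factor `a` on both sides.
  linear_combination (-a * b * (a + b)) * hk - a * (a + b) * hh + a * b * h3
    - (a + b) * hg + a * h1 - b * h2 - a * h4

theorem dividedDiff_braid (i : ℕ) (f : MvPolynomial ℕ ℤ) :
    dividedDiff i (dividedDiff (i + 1) (dividedDiff i f))
      = dividedDiff (i + 1) (dividedDiff i (dividedDiff (i + 1) f)) := by
  set a : MvPolynomial ℕ ℤ := X i - X (i + 1) with ha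
  set b : MvPolynomial ℕ ℤ := X (i + 1) - X (i + 2) with hb
  have ha0 : a ≠ 0 := X_sub_X_succ_ne_zero i
  have hb0 : b ≠ 0 := X_sub_X_succ_ne_zero (i + 1)
  have hab0 : a + b ≠ 0 := by
    rw [ha, hb, sub_add_sub_cancel, sub_ne_zero]
    intro h
    have := X_injective (σ := ℕ) (R := ℤ) h
    omega
  set s : MvPolynomial ℕ ℤ →+* MvPolynomial ℕ ℤ := (rename (Equiv.swap i (i + 1))).toRingHom
    with hs
  set t : MvPolynomial ℕ ℤ →+* MvPolynomial ℕ ℤ :=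
    (rename (Equiv.swap (i + 1) (i + 2))).toRingHom with ht
  have s_apply : ∀ p, s p = rename (Equiv.swap i (i + 1)) p := fun _ => rfl
  have t_apply : ∀ p, t p = rename (Equiv.swap (i + 1) (i + 2)) p := fun _ => rfl
  have e1 : Equiv.swap i (i + 1) (i + 2) = i + 2 :=
    Equiv.swap_apply_of_ne_of_ne (by omega) (by omega)
  have e2 : Equiv.swap (i + 1) (i + 2) i = i :=
    Equiv.swap_apply_of_ne_of_ne (by omega) (by omega)
  have sa : s a = -a := by
    rw [s_apply, ha, map_sub, rename_X, rename_X, Equiv.swap_apply_left,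
      Equiv.swap_apply_right]; ring
  have sb : s b = a + b := by
    rw [s_apply, hb, ha, map_sub, rename_X, rename_X, Equiv.swap_apply_right, e1]; ring
  have ta : t a = a + b := by
    rw [t_apply, hb, ha, map_sub, rename_X, rename_X, Equiv.swap_apply_left, e2]; ring
  have tb : t b = -b := by
    rw [t_apply, hb, map_sub, rename_X, rename_X, Equiv.swap_apply_left,
      Equiv.swap_apply_right]; ring
  have ss : ∀ p, s (s p) = p := fun p => rename_swap_rename_swap _ _ p
  have tt : ∀ p, t (t p) = p := fun p => rename_swap_rename_swap _ _ p
  have sts : ∀ p, s (t (s p)) = t (s (t p)) := by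
    intro p
    simp only [s_apply, t_apply, rename_rename_perm, ← mul_assoc, swap_braid]
  have A := mul_left_cancel₀ ha0 (braid_word_expansion s t sa sb ta ss
    (dividedDiff_spec i f) (dividedDiff_spec (i + 1) (dividedDiff i f))
    (dividedDiff_spec i (dividedDiff (i + 1) (dividedDiff i f))))
  -- The same expansion with the two reflections exchanged; the two alternating sums differ only in
  -- their longest terms, which `sts` identifies.
  have B := mul_left_cancel₀ hb0 (braid_word_expansion t s tb (ta.trans (add_comm _ _))
    (sb.trans (add_comm _ _)) tt
    (dividedDiff_spec (i + 1) f) (dividedDiff_spec i (dividedDiff (i + 1) f))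
    (dividedDiff_spec (i + 1) (dividedDiff i (dividedDiff (i + 1) f))))
  apply mul_left_cancel₀ (mul_ne_zero (mul_ne_zero ha0 hb0) hab0)
  linear_combination A - B - sts f

/-! ### Degrees and variables under divided differences -/

theorem totalDegree_dividedDiff_lt {i : ℕ} {f : MvPolynomial ℕ ℤ} (h : dividedDiff i f ≠ 0) :
    (dividedDiff i f).totalDegree < f.totalDegree := by
  have h1 := totalDegree_mul_of_isDomain (X_sub_X_succ_ne_zero i) h
  rw [← dividedDiff_spec] at h1
  have h2 := totalDegree_sub f (rename (Equiv.swap i (i + 1)) f)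
  have h3 := totalDegree_rename_le (Equiv.swap i (i + 1)) f
  have hhom : (X i - X (i + 1) : MvPolynomial ℕ ℤ).IsHomogeneous 1 :=
    (isHomogeneous_X _ _).sub (isHomogeneous_X _ _)
  have h4 := hhom.totalDegree (X_sub_X_succ_ne_zero i)
  have h5 := max_le (le_refl _) h3
  omega

/-- The component of `a * g` in degree `m + j` is `a` times that of `g` in degree `j`, so the latter
vanishes for `j ≠ d`. -/
theorem MvPolynomial.IsHomogeneous.of_mul_left {σ R : Type*} [CommRing R] [IsDomain R]
    {a g : MvPolynomial σ R} {m d : ℕ} (ha : a.IsHomogeneous m) (ha0 : a ≠ 0)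
    (h : (a * g).IsHomogeneous (m + d)) : g.IsHomogeneous d := by
  have key : ∀ j, homogeneousComponent (m + j) (a * g) = a * homogeneousComponent j g := by
    intro j
    conv_lhs => rw [← sum_homogeneousComponent g, Finset.mul_sum, map_sum]
    rw [Finset.sum_congr rfl fun e _ => homogeneousComponent_of_mem
      (ha.mul (homogeneousComponent_isHomogeneous e g))]
    by_cases hj : j ∈ Finset.range (g.totalDegree + 1)
    · simp [hj]
    · simp only [add_right_inj, Finset.sum_ite_eq, if_neg hj]
      rw [homogeneousComponent_eq_zero, mul_zero]
      simpa using hj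
  have hz : ∀ j, j ≠ d → homogeneousComponent j g = 0 := by
    intro j hj
    have h1 := key j
    rw [homogeneousComponent_of_mem h, if_neg (by omega)] at h1
    exact (mul_eq_zero.1 h1.symm).resolve_left ha0
  have hg : g = homogeneousComponent d g := by
    conv_lhs => rw [← sum_homogeneousComponent g]
    rw [Finset.sum_eq_single d (fun j _ hj => hz j hj)]
    intro hd
    exact homogeneousComponent_eq_zero _ _ (by simpa using hd)
  rw [hg]
  exact homogeneousComponent_isHomogeneous d g

theorem MvPolynomial.IsHomogeneous.dividedDiff {f : MvPolynomial ℕ ℤ} {d : ℕ}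
    (hf : f.IsHomogeneous (d + 1)) (i : ℕ) : (dividedDiff i f).IsHomogeneous d := by
  apply MvPolynomial.IsHomogeneous.of_mul_left (m := 1)
    ((isHomogeneous_X ℤ i).sub (isHomogeneous_X ℤ (i + 1))) (X_sub_X_succ_ne_zero i)
  rw [← dividedDiff_spec, add_comm 1 d]
  exact hf.sub hf.rename_isHomogeneous

theorem dividedDiff_eq_zero_of_vars {f : MvPolynomial ℕ ℤ} {i : ℕ} (h : ∀ j ∈ f.vars, j < i) :
    dividedDiff i f = 0 := by
  rw [dividedDiff_eq_zero_iff]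
  conv_rhs => rw [← rename_id_apply f]
  refine hom_congr_vars (f₁ := (rename (Equiv.swap i (i + 1)) :
    MvPolynomial ℕ ℤ →ₐ[ℤ] MvPolynomial ℕ ℤ).toRingHom) (f₂ := (rename id :
    MvPolynomial ℕ ℤ →ₐ[ℤ] MvPolynomial ℕ ℤ).toRingHom) (by ext1; simp) (fun j hj _ => ?_) rfl
  have := h j hj
  simp [Equiv.swap_apply_of_ne_of_ne (show j ≠ i by omega) (show j ≠ i + 1 by omega)]

/-- If `p` were the largest index of a variable in `f`, invariance under swapping `p` and `p + 1`
would make `p + 1` occur too. -/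
theorem eq_C_of_dividedDiff_eq_zero {f : MvPolynomial ℕ ℤ} (h : ∀ i, dividedDiff i f = 0) :
    ∃ c, f = C c := by
  have hv : f.vars = ∅ := by
    by_contra hne
    obtain ⟨p, hp, hmax⟩ := Finset.exists_max_image f.vars id (Finset.nonempty_iff_ne_empty.2 hne)
    have hs := (dividedDiff_eq_zero_iff p f).1 (h p)
    rw [← hs] at hp
    obtain ⟨q, hq, hqp⟩ := Finset.mem_image.1 (vars_rename _ _ hp)
    rw [Equiv.swap_apply_eq_iff, Equiv.swap_apply_left] at hqp
    have := hmax q hq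
    simp only [id] at this
    omega
  rw [vars_eq_empty_iff_eq_C] at hv
  exact ⟨_, hv⟩

/-! ### Descents, inversions and length -/

namespace SInf

@[ext] theorem ext_apply {u v : SInf} (h : ∀ i, u.1 i = v.1 i) : u = v :=
  Subtype.ext (Equiv.ext h)

theorem mul_simple_apply (w : SInf) (i j : ℕ) :
    (w * simple i).1 j = w.1 (Equiv.swap i (i + 1) j) := rfl

@[simp] theorem mul_simple_apply_left (w : SInf) (i : ℕ) :
    (w * simple i).1 i = w.1 (i + 1) := by
  rw [mul_simple_apply, Equiv.swap_apply_left]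

@[simp] theorem mul_simple_apply_right (w : SInf) (i : ℕ) :
    (w * simple i).1 (i + 1) = w.1 i := by
  rw [mul_simple_apply, Equiv.swap_apply_right]

theorem mul_simple_apply_of_ne (w : SInf) {i j : ℕ} (h₁ : j ≠ i) (h₂ : j ≠ i + 1) :
    (w * simple i).1 j = w.1 j := by
  rw [mul_simple_apply, Equiv.swap_apply_of_ne_of_ne h₁ h₂]

@[simp] theorem simple_mul_self (i : ℕ) : simple i * simple i = 1 :=
  Subtype.ext (Equiv.swap_mul_self _ _)

@[simp] theorem mul_simple_mul_simple (w : SInf) (i : ℕ) : w * simple i * simple i = w := by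
  rw [mul_assoc, simple_mul_self, mul_one]

theorem mul_simple_injective (i : ℕ) : Function.Injective (· * simple i) :=
  mul_left_injective (simple i)

theorem simple_comm {i j : ℕ} (h : i + 1 < j) : simple i * simple j = simple j * simple i :=
  Subtype.ext (swap_mul_swap_of_far h)

theorem simple_braid (i : ℕ) :
    simple i * simple (i + 1) * simple i = simple (i + 1) * simple i * simple (i + 1) :=
  Subtype.ext (swap_braid i)

/-- `w` has a descent at `i`. -/
def Desc (w : SInf) (i : ℕ) : Prop := w.1 (i + 1) < w.1 i

theorem not_desc_iff {w : SInf} {i : ℕ} : ¬ Desc w i ↔ w.1 i < w.1 (i + 1) := by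
  have h : w.1 i ≠ w.1 (i + 1) := fun h => by have := w.1.injective h; omega
  unfold Desc
  omega

@[simp] theorem desc_mul_simple_self {w : SInf} {i : ℕ} : Desc (w * simple i) i ↔ ¬ Desc w i := by
  rw [not_desc_iff, Desc, mul_simple_apply_left, mul_simple_apply_right]

theorem desc_mul_simple_of_far {w : SInf} {i j : ℕ} (h : i + 1 < j ∨ j + 1 < i) :
    Desc (w * simple i) j ↔ Desc w j := by
  rw [Desc, Desc, mul_simple_apply_of_ne _ (by omega) (by omega),
    mul_simple_apply_of_ne _ (by omega) (by omega)]

theorem exists_desc {w : SInf} (h : w ≠ 1) : ∃ i, Desc w i := by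
  by_contra! hc
  have hmono : StrictMono w.1 := strictMono_nat_of_lt_succ fun i => not_desc_iff.1 (hc i)
  obtain ⟨n, hn⟩ := w.2
  apply h
  ext i
  refine le_antisymm ?_ (hmono.id_le i)
  -- Taking `d = n` lands among the fixed points and bounds `w.1 i` by `i`.
  have key : ∀ d, w.1 i + d ≤ w.1 (i + d) := by
    intro d
    induction d with
    | zero => exact le_refl _
    | succ d ih => have := hmono (Nat.lt_succ_self (i + d)); simp only [Nat.succ_eq_add_one,
        add_assoc] at *; omega
  have h1 := key n
  rw [hn (i + n) (by omega)] at h1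
  simpa using h1

/-- The set of inversions of `w`. -/
def inversions (w : SInf) : Set (ℕ × ℕ) := {p | p.1 < p.2 ∧ w.1 p.2 < w.1 p.1}

theorem inversions_subset {w : SInf} {n : ℕ} (hn : ∀ i, n ≤ i → w.1 i = i) :
    inversions w ⊆ (Finset.range n ×ˢ Finset.range n : Finset (ℕ × ℕ)) := by
  rintro ⟨a, b⟩ ⟨hab, hw⟩
  simp only at hab hw
  have hb : b < n := by
    by_contra! hb
    rw [hn b hb] at hw
    have := w.1.injective (hn (w.1 a) (by omega))
    omega
  simp only [Finset.coe_product, Finset.coe_range, Set.mem_prod, Set.mem_Iio]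
  omega

theorem finite_inversions (w : SInf) : (inversions w).Finite := by
  obtain ⟨n, hn⟩ := w.2
  exact (Finset.finite_toSet _).subset (inversions_subset hn)

/-- The number of inversions of `w`. -/
noncomputable def invCount (w : SInf) : ℕ := (inversions w).ncard

theorem invCount_le_sq {w : SInf} {n : ℕ} (hn : ∀ i, n ≤ i → w.1 i = i) : invCount w ≤ n * n := by
  have := Set.ncard_le_ncard (inversions_subset hn) (Finset.finite_toSet _)
  rwa [Set.ncard_coe_finset, Finset.card_product, Finset.card_range] at this

/-- Swapping positions `i` and `i + 1` matches the inversions of `w * simple i` with those of `w`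
other than `(i, i + 1)`. -/
theorem invCount_mul_simple_of_desc {w : SInf} {i : ℕ} (h : Desc w i) :
    invCount (w * simple i) + 1 = invCount w := by
  set s := Equiv.swap i (i + 1) with hs
  have hset : inversions w
      = insert (i, i + 1) ((fun p : ℕ × ℕ => (s p.1, s p.2)) '' inversions (w * simple i)) := by
    have lt_of : ∀ {a b : ℕ}, a < b → (a, b) ≠ (i, i + 1) → s a < s b := by
      intro a b hab hne
      have : ¬ (a = i ∧ b = i + 1) := fun h => hne (by rw [h.1, h.2])
      simp only [hs, Equiv.swap_apply_def]
      split_ifs <;> omega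
    ext ⟨a, b⟩
    constructor
    · rintro ⟨hab, hw⟩
      by_cases hne : (a, b) = (i, i + 1)
      · exact Or.inl hne
      · refine Or.inr ⟨(s a, s b), ⟨lt_of hab hne, ?_⟩, by simp [hs]⟩
        change w.1 (s (s b)) < w.1 (s (s a))
        rwa [hs, Equiv.swap_apply_self, Equiv.swap_apply_self]
    · rintro (heq | ⟨⟨c, d⟩, ⟨hcd, hw⟩, heq⟩)
      · rw [Prod.mk.injEq] at heq
        rw [heq.1, heq.2]
        exact ⟨Nat.lt_succ_self i, h⟩
      · simp only [Prod.mk.injEq] at heq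
        rw [← heq.1, ← heq.2]
        simp only at hcd hw
        refine ⟨lt_of hcd ?_, hw⟩
        intro hcd'
        rw [Prod.mk.injEq] at hcd'
        rw [hcd'.1, hcd'.2, mul_simple_apply_left, mul_simple_apply_right] at hw
        exact lt_asymm hw h
  have hinj : Function.Injective (fun p : ℕ × ℕ => (s p.1, s p.2)) := by
    rintro ⟨a, b⟩ ⟨c, d⟩ hp
    simpa using hp
  rw [invCount, invCount, hset, Set.ncard_insert_of_notMem _ ((finite_inversions _).image _),
    Set.ncard_image_of_injective _ hinj]
  rintro ⟨⟨c, d⟩, ⟨hcd, -⟩, heq⟩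
  simp only [Prod.mk.injEq, hs] at heq hcd
  rw [Equiv.swap_apply_eq_iff, Equiv.swap_apply_eq_iff, Equiv.swap_apply_left,
    Equiv.swap_apply_right] at heq
  omega

theorem invCount_mul_simple_of_not_desc {w : SInf} {i : ℕ} (h : ¬ Desc w i) :
    invCount (w * simple i) = invCount w + 1 := by
  have := invCount_mul_simple_of_desc (desc_mul_simple_self.2 h)
  rwa [mul_simple_mul_simple, eq_comm] at this

@[simp] theorem invCount_one : invCount (1 : SInf) = 0 := by
  have : inversions (1 : SInf) = ∅ := by
    ext ⟨a, b⟩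
    simp only [inversions, OneMemClass.coe_one, Equiv.Perm.coe_one, id_eq, Set.mem_ofPred_eq,
      Set.mem_empty_iff_false, iff_false]
    omega
  rw [invCount, this, Set.ncard_empty]

theorem invCount_eq_zero_iff {w : SInf} : invCount w = 0 ↔ w = 1 := by
  refine ⟨fun h => ?_, fun h => h ▸ invCount_one⟩
  by_contra hne
  obtain ⟨i, hi⟩ := exists_desc hne
  have := invCount_mul_simple_of_desc hi
  omega

theorem invCount_word_le (l : List ℕ) : invCount (l.map simple).prod ≤ l.length := by
  induction l using List.reverseRecOn with
  | nil => simp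
  | append_singleton l i ih =>
    rw [List.map_append, List.prod_append, List.map_singleton, List.prod_singleton,
      List.length_append, List.length_singleton]
    by_cases h : Desc (l.map simple).prod i
    · have := invCount_mul_simple_of_desc h
      omega
    · rw [invCount_mul_simple_of_not_desc h]
      omega

theorem exists_word (w : SInf) : ∃ l : List ℕ, l.length = invCount w ∧ (l.map simple).prod = w := by
  induction hm : invCount w using Nat.strong_induction_on generalizing w with
  | _ m ih =>
  by_cases h : w = 1
  · exact ⟨[], by simp [← hm, h], by simp [h]⟩
  · obtain ⟨i, hi⟩ := exists_desc h
    have h1 := invCount_mul_simple_of_desc hi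
    obtain ⟨l, hl, hw⟩ := ih _ (by omega) (w * simple i) rfl
    refine ⟨l ++ [i], ?_, ?_⟩
    · rw [List.length_append, hl, List.length_singleton]
      omega
    · simp [hw]

theorem length_eq_invCount (w : SInf) : length w = invCount w := by
  apply le_antisymm
  · exact Nat.sInf_le (exists_word w)
  · refine le_csInf ⟨_, exists_word w⟩ ?_
    rintro m ⟨l, rfl, rfl⟩
    exact invCount_word_le l

theorem length_mul_simple_of_desc {w : SInf} {i : ℕ} (h : Desc w i) :
    length (w * simple i) + 1 = length w := by
  simpa only [length_eq_invCount] using invCount_mul_simple_of_desc h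

theorem length_mul_simple_of_not_desc {w : SInf} {i : ℕ} (h : ¬ Desc w i) :
    length (w * simple i) = length w + 1 := by
  simpa only [length_eq_invCount] using invCount_mul_simple_of_not_desc h

theorem length_eq_zero_iff {w : SInf} : length w = 0 ↔ w = 1 := by
  rw [length_eq_invCount, invCount_eq_zero_iff]

@[simp] theorem length_one : length 1 = 0 := length_eq_zero_iff.2 rfl

theorem length_mul_le (u v : SInf) : length (u * v) ≤ length u + length v := by
  obtain ⟨l, hl, rfl⟩ := exists_word u
  obtain ⟨m, hm, rfl⟩ := exists_word v
  rw [← List.prod_append, ← List.map_append]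
  simp only [length_eq_invCount]
  rw [← hl, ← hm, ← List.length_append]
  exact invCount_word_le _

theorem leftWeakLE_iff {u w : SInf} :
    LeftWeakLE u w ↔ length u + length (w * u⁻¹) = length w := by
  constructor
  · rintro ⟨v, rfl, h⟩
    rwa [mul_inv_cancel_right]
  · exact fun h => ⟨w * u⁻¹, by rw [inv_mul_cancel_right], h⟩

theorem one_leftWeakLE (w : SInf) : LeftWeakLE 1 w := by
  rw [leftWeakLE_iff]
  simp

/-- A descent of `v` is a descent of everything above `v` in left weak order, and can be
cancelled. -/
theorem leftWeakLE_iff_of_desc {v w : SInf} {i : ℕ} (hv : Desc v i) :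
    LeftWeakLE v w ↔ Desc w i ∧ LeftWeakLE (v * simple i) (w * simple i) := by
  have hquot : w * simple i * (v * simple i)⁻¹ = w * v⁻¹ := by group
  have h1 := length_mul_simple_of_desc hv
  rw [leftWeakLE_iff, leftWeakLE_iff, hquot]
  constructor
  · intro h
    have hw : Desc w i := by
      -- Otherwise `w * simple i` is longer than `w`, yet it is the product of `w * v⁻¹` and `v *
      -- simple i`, whose lengths add up to less than that of `w`.
      by_contra hw
      have h2 := length_mul_simple_of_not_desc hw
      have h3 := length_mul_le (w * v⁻¹) (v * simple i)
      rw [← mul_assoc, inv_mul_cancel_right] at h3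
      omega
    have h2 := length_mul_simple_of_desc hw
    exact ⟨hw, by omega⟩
  · rintro ⟨hw, h⟩
    have h2 := length_mul_simple_of_desc hw
    omega

end SInf

/-! ### Consistency of the recursion for Schubert polynomials -/

namespace SInf

/-- `w` fixes every `i ≥ n`. -/
def FixesFrom (n : ℕ) (w : SInf) : Prop := ∀ i, n ≤ i → w.1 i = i

theorem FixesFrom.apply_lt {n : ℕ} {w : SInf} (hw : FixesFrom n w) {i : ℕ} (hi : i < n) :
    w.1 i < n := by
  by_contra! hc
  have := w.1.injective (hw (w.1 i) hc)
  omega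

theorem FixesFrom.mul_simple {n : ℕ} {w : SInf} (hw : FixesFrom n w) {i : ℕ} (hi : i + 1 < n) :
    FixesFrom n (w * simple i) := fun j hj => by
  rw [mul_simple_apply_of_ne _ (by omega) (by omega), hw j hj]

theorem FixesFrom.lt_of_desc {n : ℕ} {w : SInf} (hw : FixesFrom n w) {i : ℕ} (h : Desc w i) :
    i + 1 < n := by
  by_contra! hc
  unfold Desc at h
  rw [hw (i + 1) hc] at h
  by_cases hi : i < n
  · have := hw.apply_lt hi
    omega
  · have := hw i (by omega)
    omega

theorem longElement_apply_of_lt {n i : ℕ} (h : i < n) : (longElement n).1 i = n - 1 - i :=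
  if_pos h

theorem longElement_apply_of_le {n i : ℕ} (h : n ≤ i) : (longElement n).1 i = i :=
  if_neg (by omega)

theorem fixesFrom_longElement (n : ℕ) : FixesFrom n (longElement n) :=
  fun _ hi => longElement_apply_of_le hi

theorem desc_longElement {n i : ℕ} (h : i + 1 < n) : Desc (longElement n) i := by
  rw [Desc, longElement_apply_of_lt h, longElement_apply_of_lt (by omega)]
  omega

theorem FixesFrom.eq_longElement {n : ℕ} {w : SInf} (hn : FixesFrom n w)
    (h : ∀ i, i + 1 < n → Desc w i) : w = longElement n := by
  have hup : ∀ i, i < n → w.1 i ≤ n - 1 - i := by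
    intro i
    induction i with
    | zero => intro hi; have := hn.apply_lt hi; omega
    | succ i ihi =>
      intro hi
      have := ihi (by omega)
      have : w.1 (i + 1) < w.1 i := h i hi
      omega
  have hlow : ∀ j, j < n → j ≤ w.1 (n - 1 - j) := by
    intro j
    induction j with
    | zero => intro _; omega
    | succ j ihj =>
      intro hj
      have h1 := ihj (by omega)
      have h2 : w.1 (n - 1 - (j + 1) + 1) < w.1 (n - 1 - (j + 1)) := h _ (by omega)
      rw [show n - 1 - (j + 1) + 1 = n - 1 - j by omega] at h2
      omega
  ext i
  by_cases hi : i < n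
  · rw [longElement_apply_of_lt hi]
    have h1 := hup i hi
    have h2 := hlow (n - 1 - i) (by omega)
    rw [show n - 1 - (n - 1 - i) = i by omega] at h2
    omega
  · rw [longElement_apply_of_le (by omega), hn i (by omega)]

/-- The permutation `longElement (n + 1) * simple 0 * ⋯ * simple (k - 1)`. -/
noncomputable def longElementChain (n : ℕ) : ℕ → SInf
  | 0 => longElement (n + 1)
  | k + 1 => longElementChain n k * simple k

/-- In one-line notation the largest value `n` travels from position 0 to position `k`, and each
entry it passes moves one place left. -/
theorem longElementChain_apply {n k : ℕ} (hk : k ≤ n) (i : ℕ) :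
    (longElementChain n k).1 i
      = if i < k then n - 1 - i else if i = k then n else if i ≤ n then n - i else i := by
  induction k generalizing i with
  | zero =>
    change (if i < n + 1 then n + 1 - 1 - i else i) = _
    split_ifs <;> omega
  | succ k ih =>
    rw [longElementChain, mul_simple_apply, ih (by omega), Equiv.swap_apply_def]
    split_ifs <;> omega

theorem desc_longElementChain {n k : ℕ} (hk : k < n) : Desc (longElementChain n k) k := by
  rw [Desc, longElementChain_apply hk.le, longElementChain_apply hk.le]
  split_ifs <;> omega

theorem longElementChain_self (n : ℕ) : longElementChain n n = longElement n := by
  ext i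
  rw [longElementChain_apply le_rfl]
  change _ = if i < n then n - 1 - i else i
  split_ifs <;> omega

end SInf

open SInf

/-- The staircase monomial attached to the long element of `S_n`. -/
noncomputable def staircase (n : ℕ) : MvPolynomial ℕ ℤ := ∏ i ∈ Finset.range n, X i ^ (n - 1 - i)

/-- The monomials interpolating between `staircase (n + 1)` and `staircase n`. -/
noncomputable def staircaseChain (n k : ℕ) : MvPolynomial ℕ ℤ :=
  ∏ i ∈ Finset.range (n + 1), X i ^ (n - 1 - i + if k ≤ i ∧ i < n then 1 else 0)

theorem staircaseChain_zero (n : ℕ) : staircaseChain n 0 = staircase (n + 1) := by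
  refine Finset.prod_congr rfl fun i hi => ?_
  rw [Finset.mem_range] at hi
  congr 1
  split_ifs <;> omega

theorem staircaseChain_self (n : ℕ) : staircaseChain n n = staircase n := by
  rw [staircaseChain, Finset.prod_range_succ, staircase]
  simp only [show n - 1 - n = 0 by omega, lt_irrefl, and_false, if_false, add_zero, pow_zero,
    mul_one]
  refine Finset.prod_congr rfl fun i hi => ?_
  rw [Finset.mem_range] at hi
  rw [if_neg (by omega), add_zero]

theorem staircaseChain_eq_X_mul {n k : ℕ} (hk : k < n) :
    staircaseChain n k = X k * staircaseChain n (k + 1) := by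
  have hmem : k ∈ Finset.range (n + 1) := Finset.mem_range.2 (by omega)
  rw [staircaseChain, staircaseChain, ← Finset.mul_prod_erase _ _ hmem,
    ← Finset.mul_prod_erase _ _ hmem, ← mul_assoc, if_pos ⟨le_rfl, hk⟩, if_neg (by omega), add_zero,
    pow_succ']
  congr 1
  refine Finset.prod_congr rfl fun i hi => ?_
  have := Finset.ne_of_mem_erase hi
  congr 2
  split_ifs <;> omega

/-- Both variables have exponent `n - 1 - k`. For `k + 1 = n` this is 0, which is why the extra 1 in
the exponent is restricted to `i < n`. -/
theorem rename_swap_staircaseChain {n k : ℕ} (hk : k < n) :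
    rename (Equiv.swap k (k + 1)) (staircaseChain n (k + 1)) = staircaseChain n (k + 1) := by
  rw [staircaseChain, map_prod]
  refine Finset.prod_equiv (Equiv.swap k (k + 1)) ?_ ?_
  · intro i
    simp only [Finset.mem_range, Equiv.swap_apply_def]
    split_ifs <;> omega
  · intro i _
    rw [map_pow, rename_X]
    congr 1
    simp only [Equiv.swap_apply_def]
    split_ifs <;> omega

theorem dividedDiff_staircaseChain {n k : ℕ} (hk : k < n) :
    dividedDiff k (staircaseChain n k) = staircaseChain n (k + 1) := by
  rw [staircaseChain_eq_X_mul hk, dividedDiff_X_mul (rename_swap_staircaseChain hk)]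

/-- The recursion for Schubert polynomials started at the long element of `S_n` only. -/
inductive IsSchubertFrom (n : ℕ) : SInf → MvPolynomial ℕ ℤ → Prop
  | long : IsSchubertFrom n (longElement n) (staircase n)
  | step (w : SInf) (f : MvPolynomial ℕ ℤ) (i : ℕ) (hw : Desc w i)
      (hf : IsSchubertFrom n w f) : IsSchubertFrom n (w * simple i) (dividedDiff i f)

namespace IsSchubertFrom

theorem fixesFrom {n : ℕ} {w : SInf} {f : MvPolynomial ℕ ℤ} (h : IsSchubertFrom n w f) :
    FixesFrom n w := by
  induction h with
  | long => exact fixesFrom_longElement n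
  | step w f i hw _ ih => exact ih.mul_simple (ih.lt_of_desc hw)

theorem up {n : ℕ} {w : SInf} {i : ℕ} {f : MvPolynomial ℕ ℤ} (hw : ¬ Desc w i)
    (h : IsSchubertFrom n (w * simple i) f) : IsSchubertFrom n w (dividedDiff i f) := by
  have := step _ f i (desc_mul_simple_self.2 hw) h
  rwa [mul_simple_mul_simple] at this

theorem eq_or_exists {n : ℕ} {w : SInf} {f : MvPolynomial ℕ ℤ} (h : IsSchubertFrom n w f) :
    (w = longElement n ∧ f = staircase n) ∨
      ∃ i g, i + 1 < n ∧ ¬ Desc w i ∧ IsSchubertFrom n (w * simple i) g ∧ f = dividedDiff i g := by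
  cases h with
  | long => exact Or.inl ⟨rfl, rfl⟩
  | step w f i hw hf =>
    exact Or.inr ⟨i, f, hf.fixesFrom.lt_of_desc hw, fun h => desc_mul_simple_self.1 h hw,
      by rwa [mul_simple_mul_simple], rfl⟩

/-- A confluence argument, by downward induction on length: two ascents of `w` lead up to a common
element, and the two ways back down agree by the commutation or the braid relation. -/
theorem existsUnique {n : ℕ} {w : SInf} (hw : FixesFrom n w) : ∃! f, IsSchubertFrom n w f := by
  induction hm : n * n - invCount w using Nat.strong_induction_on generalizing w with
  | _ m ih =>
  have up : ∀ {x : SInf} {i : ℕ}, FixesFrom n x → invCount w ≤ invCount x → i + 1 < n →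
      ¬ Desc x i → FixesFrom n (x * simple i) ∧ invCount w < invCount (x * simple i) ∧
        ∃! f, IsSchubertFrom n (x * simple i) f := by
    intro x i hx hle hi hd
    have h1 := invCount_mul_simple_of_not_desc hd
    have h2 := invCount_le_sq (hx.mul_simple hi)
    exact ⟨hx.mul_simple hi, by omega, ih _ (by omega) (hx.mul_simple hi) rfl⟩
  by_cases hlong : w = longElement n
  · subst hlong
    refine ⟨staircase n, long, fun f hf => ?_⟩
    rcases hf.eq_or_exists with h | ⟨i, _, hi, hd, -⟩
    · exact h.2
    · exact absurd (desc_longElement hi) hd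
  · have key : ∀ i j f g, i < j → i + 1 < n → j + 1 < n → ¬ Desc w i → ¬ Desc w j →
        IsSchubertFrom n (w * simple i) f → IsSchubertFrom n (w * simple j) g →
        dividedDiff i f = dividedDiff j g := by
      intro i j f g hij hi hj hdi hdj hf hg
      obtain ⟨fix_i, inv_i, uniq_i⟩ := up hw le_rfl hi hdi
      obtain ⟨fix_j, inv_j, uniq_j⟩ := up hw le_rfl hj hdj
      by_cases hfar : i + 1 < j
      · have hdij : ¬ Desc (w * simple i) j := by rwa [desc_mul_simple_of_far (Or.inl hfar)]
        have hdji : ¬ Desc (w * simple j) i := by rwa [desc_mul_simple_of_far (Or.inr hfar)]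
        obtain ⟨-, -, z, hz, -⟩ := up fix_i inv_i.le hj hdij
        have hz' : IsSchubertFrom n (w * simple j * simple i) z := by
          rwa [mul_assoc, ← simple_comm hfar, ← mul_assoc]
        rw [uniq_i.unique hf (hz.up hdij), uniq_j.unique hg (hz'.up hdji), dividedDiff_comm hfar]
      · obtain rfl : j = i + 1 := by omega
        -- Three increasing consecutive values: both braid words climb at every letter and meet
        -- where the three values are reversed.
        have h1 : w.1 i < w.1 (i + 1) := not_desc_iff.1 hdi
        have h2 : w.1 (i + 1) < w.1 (i + 2) := not_desc_iff.1 hdj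
        have a1 : ¬ Desc (w * simple i) (i + 1) := by
          rw [not_desc_iff, mul_simple_apply_right, mul_simple_apply_of_ne _ (by omega) (by omega)]
          exact h1.trans h2
        have a2 : ¬ Desc (w * simple i * simple (i + 1)) i := by
          rw [not_desc_iff, mul_simple_apply_left, mul_simple_apply_of_ne _ (by omega) (by omega),
            mul_simple_apply_left, mul_simple_apply_of_ne _ (by omega) (by omega)]
          exact h2
        have b1 : ¬ Desc (w * simple (i + 1)) i := by
          rw [not_desc_iff, mul_simple_apply_left, mul_simple_apply_of_ne _ (by omega) (by omega)]
          exact h1.trans h2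
        have b2 : ¬ Desc (w * simple (i + 1) * simple i) (i + 1) := by
          rw [not_desc_iff, mul_simple_apply_right,
            mul_simple_apply_of_ne _ (by omega) (by omega),
            mul_simple_apply_of_ne _ (by omega) (by omega), mul_simple_apply_right]
          exact h1
        obtain ⟨fix_ij, inv_ij, uniq_ij⟩ := up fix_i inv_i.le hj a1
        obtain ⟨-, -, z, hz, -⟩ := up fix_ij inv_ij.le hi a2
        have hz' : IsSchubertFrom n (w * simple (i + 1) * simple i * simple (i + 1)) z := by
          rw [mul_assoc, mul_assoc] at hz ⊢
          rwa [← mul_assoc (simple (i + 1)), ← simple_braid, mul_assoc]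
        rw [uniq_i.unique hf ((hz.up a2).up a1), uniq_j.unique hg ((hz'.up b2).up b1),
          dividedDiff_braid]
    obtain ⟨i, hi, hd⟩ : ∃ i, i + 1 < n ∧ ¬ Desc w i := by
      by_contra! hc
      exact hlong (hw.eq_longElement hc)
    obtain ⟨-, -, f, hf, huniq⟩ := up hw le_rfl hi hd
    refine ⟨dividedDiff i f, hf.up hd, fun g hg => ?_⟩
    rcases hg.eq_or_exists with h | ⟨j, g, hj, hdj, hg', rfl⟩
    · exact absurd h.1 hlong
    · rcases lt_trichotomy i j with hij | rfl | hij
      · exact (key i j f g hij hi hj hd hdj hf hg').symm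
      · rw [huniq g hg']
      · exact key j i g f hij hj hi hdj hd hg' hf

theorem longElementChain {n k : ℕ} (hk : k ≤ n) :
    IsSchubertFrom (n + 1) (longElementChain n k) (staircaseChain n k) := by
  induction k with
  | zero => rw [staircaseChain_zero]; exact long
  | succ k ih =>
    rw [← dividedDiff_staircaseChain hk]
    exact step _ _ k (desc_longElementChain hk) (ih (by omega))

/-- Makes the starting points for different `n` compatible, so that uniqueness for a fixed `n` gives
uniqueness for the whole recursion. -/
theorem succ {n : ℕ} {w : SInf} {f : MvPolynomial ℕ ℤ} (h : IsSchubertFrom n w f) :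
    IsSchubertFrom (n + 1) w f := by
  induction h with
  | long =>
    rw [← longElementChain_self, ← staircaseChain_self]
    exact longElementChain le_rfl
  | step w f i hw _ ih => exact step w f i hw ih

theorem mono {m n : ℕ} (hmn : m ≤ n) {w : SInf} {f : MvPolynomial ℕ ℤ}
    (h : IsSchubertFrom m w f) : IsSchubertFrom n w f := by
  induction n, hmn using Nat.le_induction with
  | base => exact h
  | succ n _ ih => exact ih.succ

end IsSchubertFrom

theorem IsSchubert.exists_from {w : SInf} {f : MvPolynomial ℕ ℤ} (h : IsSchubert w f) :
    ∃ n, IsSchubertFrom n w f := by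
  induction h with
  | long n => exact ⟨n, .long⟩
  | step w f i hw _ ih =>
    obtain ⟨n, hn⟩ := ih
    exact ⟨n, .step w f i hw hn⟩

theorem IsSchubert.unique {w : SInf} {f g : MvPolynomial ℕ ℤ} (hf : IsSchubert w f)
    (hg : IsSchubert w g) : f = g := by
  obtain ⟨m, hm⟩ := hf.exists_from
  obtain ⟨n, hn⟩ := hg.exists_from
  have hm' := hm.mono (le_max_left m n)
  exact (IsSchubertFrom.existsUnique hm'.fixesFrom).unique hm' (hn.mono (le_max_right m n))

theorem isSchubert_iff {w : SInf} {f : MvPolynomial ℕ ℤ} : IsSchubert w f ↔ f = schubert w :=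
  ⟨fun h => h.unique (schubert_spec w), fun h => h ▸ schubert_spec w⟩

theorem dividedDiff_schubert_of_desc {w : SInf} {i : ℕ} (h : Desc w i) :
    dividedDiff i (schubert w) = schubert (w * simple i) :=
  isSchubert_iff.1 (.step w _ i h (schubert_spec w))

/-- Here `schubert w` is itself a value of `dividedDiff i`, which squares to zero. -/
theorem dividedDiff_schubert_of_not_desc {w : SInf} {i : ℕ} (h : ¬ Desc w i) :
    dividedDiff i (schubert w) = 0 := by
  have := dividedDiff_schubert_of_desc (desc_mul_simple_self.2 h)
  rw [mul_simple_mul_simple] at this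
  rw [← this, dividedDiff_dividedDiff_self]

@[simp] theorem schubert_one : schubert 1 = 1 := by
  have h1 : longElement 0 = 1 := by
    ext i
    exact longElement_apply_of_le (Nat.zero_le i)
  have h2 := IsSchubert.long 0
  rw [h1] at h2
  simpa using (isSchubert_iff.1 h2).symm

/-! ### Homogeneity of Schubert polynomials -/

theorem invCount_longElementChain {n k : ℕ} (hk : k ≤ n) :
    invCount (SInf.longElementChain n k) + k = invCount (longElement (n + 1)) := by
  induction k with
  | zero => rfl
  | succ k ih =>
    have h1 := invCount_mul_simple_of_desc (desc_longElementChain hk)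
    have h2 := ih (by omega)
    rw [SInf.longElementChain]
    omega

theorem isHomogeneous_staircase (n : ℕ) : (staircase n).IsHomogeneous (invCount (longElement n)) := by
  have hdeg : ∀ n, invCount (longElement n) = ∑ i ∈ Finset.range n, i := by
    intro n
    induction n with
    | zero =>
      have h := invCount_le_sq (fixesFrom_longElement 0)
      simpa using h
    | succ n ih =>
      rw [← invCount_longElementChain le_rfl, longElementChain_self, ih, Finset.sum_range_succ]
  rw [hdeg, ← Finset.sum_range_reflect]
  refine IsHomogeneous.prod _ _ _ fun i _ => ?_
  simpa using (isHomogeneous_X ℤ i).pow (n - 1 - i)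

theorem IsSchubert.isHomogeneous {w : SInf} {f : MvPolynomial ℕ ℤ} (h : IsSchubert w f) :
    f.IsHomogeneous (length w) := by
  rw [length_eq_invCount]
  induction h with
  | long n => exact isHomogeneous_staircase n
  | step w f i hw _ ih =>
    rw [← invCount_mul_simple_of_desc hw] at ih
    exact ih.dividedDiff i

theorem isHomogeneous_schubert (w : SInf) : (schubert w).IsHomogeneous (length w) :=
  (schubert_spec w).isHomogeneous

/-! ### Schubert polynomials form a basis -/

open SInf

/-- Linear combinations of Schubert polynomials. -/
noncomputable abbrev schubertComb : (SInf →₀ ℤ) →ₗ[ℤ] MvPolynomial ℕ ℤ :=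
  Finsupp.linearCombination ℤ schubert

open Classical in
/-- The divided difference operator in Schubert coordinates. -/
noncomputable def coordDiff (i : ℕ) (c : SInf →₀ ℤ) : SInf →₀ ℤ :=
  (c.filter fun w => Desc w i).mapDomain (· * simple i)

theorem coordDiff_apply_of_desc (i : ℕ) (c : SInf →₀ ℤ) {w : SInf} (h : Desc w i) :
    coordDiff i c (w * simple i) = c w := by
  classical
  rw [coordDiff, Finsupp.mapDomain_apply (mul_simple_injective i)]
  exact Finsupp.filter_apply_pos _ c h

theorem coordDiff_apply_of_not_desc (i : ℕ) (c : SInf →₀ ℤ) {w : SInf} (h : ¬ Desc w i) :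
    coordDiff i c w = c (w * simple i) := by
  have := coordDiff_apply_of_desc i c (desc_mul_simple_self.2 h)
  rwa [mul_simple_mul_simple] at this

theorem dividedDiff_schubertComb (i : ℕ) (c : SInf →₀ ℤ) :
    dividedDiff i (schubertComb c) = schubertComb (coordDiff i c) := by
  classical
  rw [coordDiff, Finsupp.linearCombination_mapDomain, Finsupp.linearCombination_apply,
    Finsupp.linearCombination_apply, Finsupp.sum_filter_index, ← dividedDiffLin_apply,
    Finsupp.sum, map_sum, Finsupp.support_filter, Finset.sum_filter]
  refine Finset.sum_congr rfl fun w _ => ?_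
  rw [map_smul, dividedDiffLin_apply]
  split_ifs with h
  · rw [dividedDiff_schubert_of_desc h, Function.comp_apply]
  · rw [dividedDiff_schubert_of_not_desc h, smul_zero]

open Classical in
theorem eval_zero_schubert (w : SInf) :
    eval (fun _ => 0) (schubert w) = if w = 1 then 1 else 0 := by
  split_ifs with h
  · rw [h, schubert_one, map_one]
  · rw [eval_zero', constantCoeff_eq]
    exact (isHomogeneous_schubert w).coeff_eq_zero (by
      rw [map_zero]
      exact fun h0 => h (length_eq_zero_iff.1 h0.symm))

theorem eval_zero_schubertComb (c : SInf →₀ ℤ) : eval (fun _ => 0) (schubertComb c) = c 1 := by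
  classical
  rw [Finsupp.linearCombination_apply, Finsupp.sum, map_sum]
  simp only [smul_eval, eval_zero_schubert, mul_ite, mul_one, mul_zero, Finset.sum_ite_eq']
  split_ifs with h
  · rfl
  · exact (Finsupp.notMem_support_iff.1 h).symm

/-- A descent of `v` moves the coefficient at `v` to a shorter element; at the identity it is the
value at 0. -/
theorem eq_zero_of_schubertComb_eq_zero {c : SInf →₀ ℤ} (h : schubertComb c = 0) : c = 0 := by
  ext v
  induction hm : length v using Nat.strong_induction_on generalizing v c with
  | _ m ih =>
  by_cases hv : v = 1
  · rw [hv, ← eval_zero_schubertComb, h, map_zero, Finsupp.zero_apply]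
  · obtain ⟨i, hi⟩ := exists_desc hv
    have h1 := length_mul_simple_of_desc hi
    have h2 := ih _ (by omega) (c := coordDiff i c)
      (by rw [← dividedDiff_schubertComb, h, dividedDiff_zero]) (v * simple i) rfl
    rwa [coordDiff_apply_of_desc i c hi] at h2

theorem schubertComb_injective : Function.Injective schubertComb :=
  (injective_iff_map_eq_zero _).2 fun _ => eq_zero_of_schubertComb_eq_zero

theorem coordDiff_apply_eq_zero (i : ℕ) (c : SInf →₀ ℤ) {w : SInf} (h : Desc w i) :
    coordDiff i c w = 0 := by
  have hs : schubertComb (coordDiff i (coordDiff i c)) = 0 := by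
    rw [← dividedDiff_schubertComb, ← dividedDiff_schubertComb, dividedDiff_dividedDiff_self]
  rw [← coordDiff_apply_of_desc i _ h, eq_zero_of_schubertComb_eq_zero hs, Finsupp.zero_apply]

/-- Antidifferentiation: if `∂ₘ f` is a combination of Schubert polynomials, then subtracting a
suitable combination from `f` makes it invariant under one more simple transposition. -/
theorem exists_dividedDiff_sub_eq_zero {m : ℕ} {f : MvPolynomial ℕ ℤ}
    (hf : ∀ j, m + 1 ≤ j → dividedDiff j f = 0) {a : SInf →₀ ℤ}
    (ha : schubertComb a = dividedDiff m f) :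
    ∃ b, ∀ j, m ≤ j → dividedDiff j (f - schubertComb b) = 0 := by
  -- The relations among divided differences become vanishing conditions on `a`: `a_desc` from
  -- squaring to zero, `a_far` from commutation, `a_next` from the braid relation.
  have a_desc : ∀ x, Desc x m → a x = 0 := by
    intro x hx
    have h1 : coordDiff m a = 0 := eq_zero_of_schubertComb_eq_zero (by
      rw [← dividedDiff_schubertComb, ha, dividedDiff_dividedDiff_self])
    rw [← coordDiff_apply_of_desc m a hx, h1, Finsupp.zero_apply]
  have a_far : ∀ j x, m + 1 < j → Desc x j → a x = 0 := by
    intro j x hj hx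
    have h1 : coordDiff j a = 0 := eq_zero_of_schubertComb_eq_zero (by
      rw [← dividedDiff_schubertComb, ha, ← dividedDiff_comm hj, hf j (by omega),
        dividedDiff_zero])
    rw [← coordDiff_apply_of_desc j a hx, h1, Finsupp.zero_apply]
  have a_next : ∀ x, Desc x (m + 1) → Desc (x * simple (m + 1)) m → a x = 0 := by
    intro x hx hx'
    have h1 : coordDiff m (coordDiff (m + 1) a) = 0 := eq_zero_of_schubertComb_eq_zero (by
      rw [← dividedDiff_schubertComb, ← dividedDiff_schubertComb, ha, dividedDiff_braid,
        hf (m + 1) le_rfl, dividedDiff_zero, dividedDiff_zero])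
    rw [← coordDiff_apply_of_desc (m + 1) a hx, ← coordDiff_apply_of_desc m _ hx', h1,
      Finsupp.zero_apply]
  -- Since `a` lives on elements without descent at `m`, moving each up by `simple m` inverts
  -- `coordDiff m`.
  set b : SInf →₀ ℤ := a.mapDomain (· * simple m) with hb
  have b_apply : ∀ x, b x = a (x * simple m) := by
    intro x
    rw [← Finsupp.mapDomain_apply (mul_simple_injective m) a]
    simp only [mul_simple_mul_simple, hb]
  refine ⟨b, fun j hj => ?_⟩
  rw [← dividedDiffLin_apply, map_sub, dividedDiffLin_apply, dividedDiffLin_apply,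
    dividedDiff_schubertComb]
  rcases hj.eq_or_lt with rfl | hj
  · rw [← ha, sub_eq_zero]
    congr 1
    ext x
    by_cases hx : Desc x m
    · rw [a_desc x hx, coordDiff_apply_eq_zero m b hx]
    · rw [coordDiff_apply_of_not_desc m b hx, b_apply, mul_simple_mul_simple]
  · rw [hf j hj, zero_sub, neg_eq_zero]
    have hb0 : ∀ x, Desc x j → b x = 0 := by
      intro x hx
      rw [b_apply]
      by_cases hjm : m + 1 < j
      · exact a_far j _ hjm ((desc_mul_simple_of_far (Or.inl hjm)).2 hx)
      · obtain rfl : j = m + 1 := by omega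
        by_cases hd : Desc (x * simple m) m
        · exact a_desc _ hd
        · have h1 : x.1 (m + 2) < x.1 (m + 1) := hx
          have h2 : x.1 (m + 1) < x.1 m := by
            rwa [not_desc_iff, mul_simple_apply_left, mul_simple_apply_right] at hd
          apply a_next
          · rw [Desc, mul_simple_apply_right, mul_simple_apply_of_ne _ (by omega) (by omega)]
            exact h1.trans h2
          · rw [Desc, mul_simple_apply_left, mul_simple_apply_of_ne _ (by omega) (by omega),
              mul_simple_apply_of_ne _ (by omega) (by omega), mul_simple_apply_left]
            exact h1
    have : coordDiff j b = 0 := by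
      ext x
      by_cases hx : Desc x j
      · rw [coordDiff_apply_eq_zero j b hx, Finsupp.zero_apply]
      · rw [coordDiff_apply_of_not_desc j b hx, hb0 _ (desc_mul_simple_self.2 hx),
          Finsupp.zero_apply]
    rw [this, map_zero]

/-- Antidifferentiation lowers `m` until `f` is constant; subtracting Schubert combinations
preserves `hdiff`. -/
theorem exists_schubertComb_eq_of_dividedDiff {f : MvPolynomial ℕ ℤ}
    (hdiff : ∀ i, ∃ a, schubertComb a = dividedDiff i f) {m : ℕ}
    (hf : ∀ j, m ≤ j → dividedDiff j f = 0) : ∃ a, schubertComb a = f := by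
  induction m generalizing f with
  | zero =>
    obtain ⟨c, rfl⟩ := eq_C_of_dividedDiff_eq_zero fun i => hf i (Nat.zero_le i)
    refine ⟨Finsupp.single 1 c, ?_⟩
    rw [Finsupp.linearCombination_single, schubert_one, smul_eq_C_mul, mul_one]
  | succ m ih =>
    obtain ⟨a, ha⟩ := hdiff m
    obtain ⟨b, hb⟩ := exists_dividedDiff_sub_eq_zero hf ha
    obtain ⟨c, hc⟩ := ih (fun i => by
      obtain ⟨e, he⟩ := hdiff i
      refine ⟨e - coordDiff i b, ?_⟩
      rw [map_sub, he, ← dividedDiff_schubertComb]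
      exact (map_sub (dividedDiffLin i) _ _).symm) hb
    exact ⟨c + b, by rw [map_add, hc, sub_add_cancel]⟩

theorem schubertComb_surjective : Function.Surjective schubertComb := by
  intro f
  induction hd : f.totalDegree using Nat.strong_induction_on generalizing f with
  | _ d ih =>
  refine exists_schubertComb_eq_of_dividedDiff (m := f.vars.sup id + 1) (fun i => ?_)
    fun j hj => dividedDiff_eq_zero_of_vars fun k hk => ?_
  · by_cases h0 : dividedDiff i f = 0
    · exact ⟨0, by rw [map_zero, h0]⟩
    · exact ih _ (hd ▸ totalDegree_dividedDiff_lt h0) _ rfl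
  · have : k ≤ f.vars.sup id := Finset.le_sup (f := id) hk
    omega

/-- The coordinates of a polynomial in the Schubert basis. -/
noncomputable def schubertCoords : MvPolynomial ℕ ℤ ≃ₗ[ℤ] (SInf →₀ ℤ) :=
  (LinearEquiv.ofBijective schubertComb ⟨schubertComb_injective, schubertComb_surjective⟩).symm

@[simp] theorem schubertComb_schubertCoords (f : MvPolynomial ℕ ℤ) :
    schubertComb (schubertCoords f) = f :=
  LinearEquiv.apply_symm_apply
    (LinearEquiv.ofBijective schubertComb ⟨schubertComb_injective, schubertComb_surjective⟩) f

theorem schubertCoords_dividedDiff (i : ℕ) (f : MvPolynomial ℕ ℤ) :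
    schubertCoords (dividedDiff i f) = coordDiff i (schubertCoords f) :=
  schubertComb_injective (by
    rw [← dividedDiff_schubertComb, schubertComb_schubertCoords, schubertComb_schubertCoords])

theorem structureCoeff_eq (u v : SInf) :
    structureCoeff u v = schubertCoords (schubert u * schubert v) :=
  schubertComb_injective (by
    rw [schubertComb_schubertCoords]
    exact Classical.epsilon_spec
      (p := fun c : SInf →₀ ℤ => Finsupp.linearCombination ℤ schubert c = schubert u * schubert v)
      (schubertComb_surjective _))

/-- The terms of the expansion indexed by a given length sum to the homogeneous component of that
degree. -/
theorem schubertCoords_eq_zero_of_isHomogeneous {f : MvPolynomial ℕ ℤ} {d : ℕ}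
    (hf : f.IsHomogeneous d) {w : SInf} (hw : length w ≠ d) : schubertCoords f w = 0 := by
  classical
  have h : schubertComb ((schubertCoords f).filter fun x => length x = length w) = 0 := by
    have h1 := homogeneousComponent_of_mem hf (m := length w)
    rw [if_neg hw] at h1
    rw [← h1]
    conv_rhs => rw [← schubertComb_schubertCoords f]
    rw [Finsupp.linearCombination_apply, Finsupp.linearCombination_apply,
      Finsupp.sum_filter_index, Finsupp.sum, map_sum, Finsupp.support_filter, Finset.sum_filter]
    refine Finset.sum_congr rfl fun x _ => ?_
    rw [map_smul, homogeneousComponent_of_mem (isHomogeneous_schubert x), smul_ite, smul_zero]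
    simp only [eq_comm]
  have h2 := DFunLike.congr_fun (eq_zero_of_schubertComb_eq_zero h) w
  rwa [Finsupp.filter_apply_pos (fun x => length x = length w) _ rfl] at h2

theorem structureCoeff_eq_zero {u v w : SInf} (h : length w ≠ length u + length v) :
    structureCoeff u v w = 0 := by
  rw [structureCoeff_eq]
  exact schubertCoords_eq_zero_of_isHomogeneous
    ((isHomogeneous_schubert u).mul (isHomogeneous_schubert v)) h

/-! ### Shifting all variables by one -/

/-- The substitution `x_i ↦ x_i + 1`. -/
noncomputable def shiftVars : MvPolynomial ℕ ℤ →ₐ[ℤ] MvPolynomial ℕ ℤ := aeval fun i => X i + 1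

theorem shiftVars_rename (σ : ℕ → ℕ) (f : MvPolynomial ℕ ℤ) :
    shiftVars (rename σ f) = rename σ (shiftVars f) := by
  have : shiftVars.comp (rename σ) = (rename σ).comp shiftVars := by
    ext i
    simp [shiftVars]
  exact DFunLike.congr_fun this f

theorem dividedDiff_shiftVars (i : ℕ) (f : MvPolynomial ℕ ℤ) :
    dividedDiff i (shiftVars f) = shiftVars (dividedDiff i f) :=
  dividedDiff_eq_of_mul_eq (by
    rw [← shiftVars_rename, ← map_sub, dividedDiff_spec, map_mul, map_sub]
    simp [shiftVars])

theorem eval_zero_shiftVars (f : MvPolynomial ℕ ℤ) :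
    eval (fun _ => 0) (shiftVars f) = eval (fun _ => 1) f := by
  have : (aeval fun _ => (0 : ℤ)).comp shiftVars = (aeval fun _ => (1 : ℤ) :
      MvPolynomial ℕ ℤ →ₐ[ℤ] ℤ) := by
    ext i
    simp [shiftVars]
  exact DFunLike.congr_fun this f

open Classical in
/-- The expansion of a shifted Schubert polynomial in the Schubert basis. -/
theorem schubertCoords_shiftVars_schubert (w v : SInf) :
    schubertCoords (shiftVars (schubert w)) v
      = if LeftWeakLE v w then schubertAtOne (w * v⁻¹) else 0 := by
  induction hm : length v using Nat.strong_induction_on generalizing v w with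
  | _ m ih =>
  by_cases hv : v = 1
  · rw [hv, if_pos (one_leftWeakLE w), ← eval_zero_schubertComb, schubertComb_schubertCoords,
      eval_zero_shiftVars, inv_one, mul_one, schubertAtOne]
  · obtain ⟨i, hi⟩ := exists_desc hv
    have h1 := length_mul_simple_of_desc hi
    -- Cancelling `simple i` on the right of both `v` and `w` leaves `w * v⁻¹` unchanged; if `w` has
    -- no descent at `i`, both sides vanish.
    rw [← coordDiff_apply_of_desc i _ hi, ← schubertCoords_dividedDiff, dividedDiff_shiftVars]
    by_cases hw : Desc w i
    · have hquot : w * simple i * (v * simple i)⁻¹ = w * v⁻¹ := by group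
      rw [dividedDiff_schubert_of_desc hw, ih _ (by omega) _ _ rfl, hquot]
      simp only [leftWeakLE_iff_of_desc hi, hw, true_and]
    · rw [dividedDiff_schubert_of_not_desc hw, map_zero, map_zero, if_neg, Finsupp.zero_apply]
      exact fun h => hw ((leftWeakLE_iff_of_desc hi).1 h).1

/-! ### The linear relation between structure coefficients -/

open SInf

/-- A `finsum` with infinite support is 0 by default, so a finite set containing all nonzero terms
has to be supplied. -/
theorem finsum_cond_eq_sum_ite {α M : Type*} [AddCommMonoid M] {p : α → Prop} [DecidablePred p]
    {f : α → M} {s : Finset α} (h : ∀ x, p x → f x ≠ 0 → x ∈ s) :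
    ∑ᶠ (x : α) (_ : p x), f x = ∑ x ∈ s, if p x then f x else 0 := by
  simp only [finsum_eq_if]
  refine finsum_eq_sum_of_support_subset _ fun x hx => ?_
  rw [Function.mem_support, ne_eq, ite_eq_right_iff, Classical.not_imp] at hx
  exact h x hx.1 hx.2

theorem schubertCoords_shiftVars_mul_left (u v w : SInf) (k : ℕ)
    (hw : length w + k = length u + length v) :
    schubertCoords (shiftVars (schubert u * schubert v)) w
      = ∑ᶠ (w' : SInf) (_ : LeftWeakLE w w' ∧ length w' = length w + k),
          structureCoeff u v w' * schubertAtOne (w' * w⁻¹) := by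
  classical
  rw [finsum_cond_eq_sum_ite (s := (structureCoeff u v).support) fun x _ hx =>
      Finsupp.mem_support_iff.2 (left_ne_zero_of_mul hx),
    ← schubertComb_schubertCoords (schubert u * schubert v), ← structureCoeff_eq,
    Finsupp.linearCombination_apply, Finsupp.sum, map_sum, map_sum, Finsupp.finsetSum_apply]
  refine Finset.sum_congr rfl fun x hx => ?_
  -- The length condition holds automatically on the support, by homogeneity.
  have hlen : length x = length w + k := by
    by_contra hne
    exact Finsupp.mem_support_iff.1 hx (structureCoeff_eq_zero (by omega))
  rw [map_smul, map_smul, Finsupp.smul_apply, schubertCoords_shiftVars_schubert, smul_eq_mul,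
    mul_ite, mul_zero]
  simp only [hlen, and_true]

theorem schubertCoords_shiftVars_mul_right (u v w : SInf) :
    schubertCoords (shiftVars (schubert u) * shiftVars (schubert v)) w
      = ∑ x ∈ (schubertCoords (shiftVars (schubert u))).support,
          ∑ y ∈ (schubertCoords (shiftVars (schubert v))).support,
            structureCoeff x y w * schubertCoords (shiftVars (schubert u)) x
              * schubertCoords (shiftVars (schubert v)) y := by
  conv_lhs => rw [← schubertComb_schubertCoords (shiftVars (schubert u)),
    ← schubertComb_schubertCoords (shiftVars (schubert v)), Finsupp.linearCombination_apply,
    Finsupp.linearCombination_apply, Finsupp.sum, Finsupp.sum, Finset.sum_mul_sum, map_sum,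
    Finsupp.finsetSum_apply]
  refine Finset.sum_congr rfl fun x _ => ?_
  rw [map_sum, Finsupp.finsetSum_apply]
  refine Finset.sum_congr rfl fun y _ => ?_
  rw [smul_mul_smul_comm, map_smul, ← structureCoeff_eq, Finsupp.smul_apply, smul_eq_mul]
  ring

theorem leftWeakLE_of_mem_support {u x : SInf}
    (hx : x ∈ (schubertCoords (shiftVars (schubert u))).support) : LeftWeakLE x u := by
  rw [Finsupp.mem_support_iff, schubertCoords_shiftVars_schubert] at hx
  by_contra h
  exact hx (if_neg h)

theorem mem_support_of_leftWeakLE {u x : SInf} (h : LeftWeakLE x u)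
    (h0 : schubertAtOne (u * x⁻¹) ≠ 0) :
    x ∈ (schubertCoords (shiftVars (schubert u))).support := by
  rwa [Finsupp.mem_support_iff, schubertCoords_shiftVars_schubert, if_pos h]

theorem length_le_of_leftWeakLE {u x : SInf} (h : LeftWeakLE x u) : length x ≤ length u := by
  obtain ⟨_, _, h⟩ := h
  omega

theorem mainTheorem4 (u v : SInf) (k : ℕ) (hk : 1 ≤ k)
    (hk' : k ≤ SInf.length u + SInf.length v) (w : SInf)
    (hw : SInf.length w + k = SInf.length u + SInf.length v) :
    -- the recursion defines the Schubert polynomials unambiguously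
    (∀ (p : SInf) (f : MvPolynomial ℕ ℤ), IsSchubert p f ↔ f = schubert p) ∧
    -- the Schubert polynomials are a basis, so that the structure coefficients are defined
    (∀ f : MvPolynomial ℕ ℤ, ∃! c : SInf →₀ ℤ, Finsupp.linearCombination ℤ schubert c = f) ∧
    -- the linear relation
    ∑ᶠ (w' : SInf) (_ : SInf.LeftWeakLE w w' ∧ SInf.length w' = SInf.length w + k),
        structureCoeff u v w' * schubertAtOne (w' * w⁻¹) =
      ∑ i ∈ Finset.range (k + 1),
        ∑ᶠ (u' : SInf) (_ : SInf.LeftWeakLE u' u ∧ SInf.length u' + i = SInf.length u),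
          ∑ᶠ (v' : SInf) (_ : SInf.LeftWeakLE v' v ∧ SInf.length v' + (k - i) = SInf.length v),
            structureCoeff u' v' w * schubertAtOne (u * u'⁻¹) * schubertAtOne (v * v'⁻¹) := by
  classical
  refine ⟨fun _ _ => isSchubert_iff,
    Function.bijective_iff_existsUnique _ |>.1 ⟨schubertComb_injective, schubertComb_surjective⟩,
    ?_⟩
  rw [← schubertCoords_shiftVars_mul_left u v w k hw, map_mul, schubertCoords_shiftVars_mul_right]
  set a := schubertCoords (shiftVars (schubert u)) with ha
  set b := schubertCoords (shiftVars (schubert v)) with hb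
  have inner : ∀ (i : ℕ) (x : SInf),
      ∑ᶠ (y : SInf) (_ : LeftWeakLE y v ∧ length y + (k - i) = length v),
          structureCoeff x y w * schubertAtOne (u * x⁻¹) * schubertAtOne (v * y⁻¹)
        = ∑ y ∈ b.support, if LeftWeakLE y v ∧ length y + (k - i) = length v then
            structureCoeff x y w * schubertAtOne (u * x⁻¹) * schubertAtOne (v * y⁻¹) else 0 :=
    fun i x => finsum_cond_eq_sum_ite fun y hy hne =>
      mem_support_of_leftWeakLE hy.1 (right_ne_zero_of_mul hne)
  simp only [inner]
  have outer : ∀ i : ℕ,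
      ∑ᶠ (x : SInf) (_ : LeftWeakLE x u ∧ length x + i = length u),
          ∑ y ∈ b.support, (if LeftWeakLE y v ∧ length y + (k - i) = length v then
            structureCoeff x y w * schubertAtOne (u * x⁻¹) * schubertAtOne (v * y⁻¹) else 0)
        = ∑ x ∈ a.support, if LeftWeakLE x u ∧ length x + i = length u then
          ∑ y ∈ b.support, (if LeftWeakLE y v ∧ length y + (k - i) = length v then
            structureCoeff x y w * schubertAtOne (u * x⁻¹) * schubertAtOne (v * y⁻¹) else 0)
          else 0 :=
    fun i => finsum_cond_eq_sum_ite fun x hx hne =>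
      mem_support_of_leftWeakLE hx.1 fun h0 => hne (by simp [h0])
  simp only [outer]
  rw [Finset.sum_comm (s := Finset.range (k + 1))]
  refine Finset.sum_congr rfl fun x hx => ?_
  have hxu := leftWeakLE_of_mem_support hx
  have ax : a x = schubertAtOne (u * x⁻¹) := by
    rw [ha, schubertCoords_shiftVars_schubert, if_pos hxu]
  have hxlen := length_le_of_leftWeakLE hxu
  have pull : ∀ i : ℕ,
      (if LeftWeakLE x u ∧ length x + i = length u then
          ∑ y ∈ b.support, (if LeftWeakLE y v ∧ length y + (k - i) = length v then
            structureCoeff x y w * schubertAtOne (u * x⁻¹) * schubertAtOne (v * y⁻¹) else 0)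
          else 0)
        = ∑ y ∈ b.support, if length x + i = length u ∧ LeftWeakLE y v ∧
            length y + (k - i) = length v then
            structureCoeff x y w * schubertAtOne (u * x⁻¹) * schubertAtOne (v * y⁻¹) else 0 := by
    intro i
    by_cases h : length x + i = length u
    · simp only [hxu, h, true_and, if_true]
    · simp only [h, and_false, false_and, if_false, Finset.sum_const_zero]
  simp only [pull]
  rw [Finset.sum_comm (s := Finset.range (k + 1))]
  refine Finset.sum_congr rfl fun y hy => ?_
  have hyv := leftWeakLE_of_mem_support hy
  have yb : b y = schubertAtOne (v * y⁻¹) := by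
    rw [hb, schubertCoords_shiftVars_schubert, if_pos hyv]
  have hylen := length_le_of_leftWeakLE hyv
  rw [ax, yb]
  by_cases hlen : length w = length x + length y
  · rw [Finset.sum_eq_single (length u - length x), if_pos ⟨by omega, hyv, by omega⟩]
    · exact fun i _ hi => if_neg fun h => hi (by omega)
    · exact fun h => absurd (Finset.mem_range.2 (by omega)) h
  · simp only [structureCoeff_eq_zero hlen, zero_mul, ite_self, Finset.sum_const_zero]
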